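/- Let $\mathbb C$ be a (Barr-)exact category: $\mathbb C$ has finite limits, every morphism factors as a regular epimorphism followed by a monomorphism, regular epimorphisms are stable under pullback, and every internal equivalence relation in $\mathbb C$ is the kernel pair of some morphism. Let $\mathsf{Cat}(\mathbb C)$ be the category of internal categories and internal functors in $\mathbb C$; let $\mathsf{PreOrd}(\mathbb C)$ be the category of internal preorders $(A,\rho)$ in $\mathbb C$, i.e. reflexive and transitive relations $\langle r_1,r_2\rangle\colon \rho\rightarrowtail A\times A$ (a morphism $(A,\rho)\to(B,\sigma)$ is a pair $f\colon A\to B$, $\overline f\colon\rho\to\sigma$ with $f r_i=s_i\overline f$ for $i=1,2$); and let $\mathsf{ParOrd}(\mathbb C)$ be its full subcategory of internal partial orders, i.e. of those preorders for which $\rho\wedge\rho^{o}$ is the discrete relation $\Delta_A=\langle 1_A,1_A\rangle$ on $A$. Let $U\colon\mathsf{ParOrd}(\mathbb C)\to\mathsf{PreOrd}(\mathbb C)$ and $V\colon\mathsf{PreOrd}(\mathbb C)\to\mathsf{Cat}(\mathbb C)$ be the inclusions ($V$ regards a preorder $(A,\rho)$ as the internal category with object of objects $A$ and object of arrows $\rho$),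 and let $W=VU\colon\mathsf{ParOrd}(\mathbb C)\to\mathsf{Cat}(\mathbb C)$. A left adjoint $R\colon\mathbb B\to\mathbb A$ of the inclusion $I\colon\mathbb A\to\mathbb B$ of a reflective subcategory, with unit $\eta$, is said to have *stable units* if it preserves every pullback $$\begin{array}{ccc} P & \xrightarrow{\;p_2\;} & Y\\ {\scriptstyle p_1}\downarrow & & \downarrow{\scriptstyle\varphi}\\ X & \xrightarrow{\;\eta_X\;} & IR(X)\end{array}$$ in $\mathbb B$, where $X$ and $Y$ are objects of $\mathbb B$ and $\varphi$ is an arbitrary morphism. Then $V$, $U$ and $W$ are full and faithful and have left adjoints, and the reflector $L\colon\mathsf{Cat}(\mathbb C)\to\mathsf{ParOrd}(\mathbb C)$, left adjoint to $W$, has stable units. In particular, if $G\colon\mathsf{Cat}(\mathbb C)\to\mathsf{PreOrd}(\mathbb C)$ is left adjoint to $V$ and $F\colon\mathsf{PreOrd}(\mathbb C)\to\mathsf{ParOrd}(\mathbb C)$ is left adjoint to $U$, then the composite reflector $FG$, with the composite adjunction, has stable units. -/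

import Mathlib

open CategoryTheory CategoryTheory.Limits

universe v u v₁ v₂ u₁ u₂

noncomputable section

/-- A (Barr) exact category: a regular category in which every internal equivalence relation is
effective, i.e. is the kernel pair of some morphism. -/
class BarrExact (C : Type u) [Category.{v} C] : Prop extends Regular C where
  effective : ∀ {R X : C} (r₁ r₂ : R ⟶ X), IsEquivalenceRelation r₁ r₂ →
    ∃ (Y : C) (f : X ⟶ Y), IsKernelPair f r₁ r₂

/-- An internal category: an object of objects `obj₀`, an object of arrows `arr`, domain,
codomain, identities, and a composition defined on the pullback of composable pairs `(f, g)`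
with `cod f = dom g`. -/
structure InternalCat (C : Type u) [Category.{v} C] [HasFiniteLimits C] where
  obj₀ : C
  arr : C
  dom : arr ⟶ obj₀
  cod : arr ⟶ obj₀
  ident : obj₀ ⟶ arr
  comp : pullback cod dom ⟶ arr
  ident_dom : ident ≫ dom = 𝟙 obj₀
  ident_cod : ident ≫ cod = 𝟙 obj₀
  comp_dom : comp ≫ dom = pullback.fst cod dom ≫ dom
  comp_cod : comp ≫ cod = pullback.snd cod dom ≫ cod
  ident_comp : pullback.lift (dom ≫ ident) (𝟙 arr)
    (by rw [Category.assoc, ident_cod, Category.comp_id, Category.id_comp]) ≫ comp = 𝟙 arr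
  comp_ident : pullback.lift (𝟙 arr) (cod ≫ ident)
    (by rw [Category.assoc, ident_dom, Category.comp_id, Category.id_comp]) ≫ comp = 𝟙 arr
  /-- Associativity, on the object of composable triples
  `(f, g, h) = ((f, g), (g, h))`: `(f g) h = f (g h)`. -/
  assoc :
    pullback.lift
        (pullback.fst (pullback.snd cod dom) (pullback.fst cod dom) ≫ comp)
        (pullback.snd (pullback.snd cod dom) (pullback.fst cod dom) ≫ pullback.snd cod dom)
        (by rw [Category.assoc, comp_cod, ← Category.assoc, pullback.condition, Category.assoc,
              pullback.condition, Category.assoc]) ≫ comp =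
      pullback.lift
        (pullback.fst (pullback.snd cod dom) (pullback.fst cod dom) ≫ pullback.fst cod dom)
        (pullback.snd (pullback.snd cod dom) (pullback.fst cod dom) ≫ comp)
        (by rw [Category.assoc, Category.assoc, comp_dom, pullback.condition, ← Category.assoc,
              pullback.condition, Category.assoc]) ≫ comp

/-- An internal functor. -/
@[ext]
structure InternalCat.Hom {C : Type u} [Category.{v} C] [HasFiniteLimits C]
    (A B : InternalCat C) where
  onObj : A.obj₀ ⟶ B.obj₀
  onArr : A.arr ⟶ B.arr
  onArr_dom : onArr ≫ B.dom = A.dom ≫ onObj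
  onArr_cod : onArr ≫ B.cod = A.cod ≫ onObj
  ident_onArr : A.ident ≫ onArr = onObj ≫ B.ident
  comp_onArr : A.comp ≫ onArr =
    pullback.map A.cod A.dom B.cod B.dom onArr onArr onObj onArr_cod.symm onArr_dom.symm ≫ B.comp

instance InternalCat.instCategory {C : Type u} [Category.{v} C] [HasFiniteLimits C] :
    Category (InternalCat C) where
  Hom A B := InternalCat.Hom A B
  id A :=
    { onObj := 𝟙 _
      onArr := 𝟙 _
      onArr_dom := by simp
      onArr_cod := by simp
      ident_onArr := by simp
      comp_onArr := by simp }
  comp f g :=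
    { onObj := f.onObj ≫ g.onObj
      onArr := f.onArr ≫ g.onArr
      onArr_dom := by
        rw [Category.assoc, g.onArr_dom, ← Category.assoc, f.onArr_dom, Category.assoc]
      onArr_cod := by
        rw [Category.assoc, g.onArr_cod, ← Category.assoc, f.onArr_cod, Category.assoc]
      ident_onArr := by
        rw [← Category.assoc, f.ident_onArr, Category.assoc, g.ident_onArr, Category.assoc]
      comp_onArr := by
        rw [← Category.assoc, f.comp_onArr, Category.assoc, g.comp_onArr, ← Category.assoc]
        congr 1
        ext <;> simp [pullback.map, pullback.lift_fst, pullback.lift_snd, pullback.lift_fst_assoc,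
          pullback.lift_snd_assoc] }
  id_comp f := InternalCat.Hom.ext (Category.id_comp _) (Category.id_comp _)
  comp_id f := InternalCat.Hom.ext (Category.comp_id _) (Category.comp_id _)
  assoc f g h := InternalCat.Hom.ext (Category.assoc _ _ _) (Category.assoc _ _ _)

/-- An internal preorder `(A, ρ)`: a relation `⟨r₁, r₂⟩ : ρ ↣ A × A` that is reflexive and
transitive. As `r₁, r₂` are jointly monic, the morphisms witnessing reflexivity and transitivity
are unique. -/
structure InternalPreord (C : Type u) [Category.{v} C] [HasFiniteLimits C] where
  carrier : C
  rel : C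
  r₁ : rel ⟶ carrier
  r₂ : rel ⟶ carrier
  jointlyMono : JointlyMono₂ r₁ r₂
  refl : carrier ⟶ rel
  refl_r₁ : refl ≫ r₁ = 𝟙 carrier
  refl_r₂ : refl ≫ r₂ = 𝟙 carrier
  trans : pullback r₂ r₁ ⟶ rel
  trans_r₁ : trans ≫ r₁ = pullback.fst r₂ r₁ ≫ r₁
  trans_r₂ : trans ≫ r₂ = pullback.snd r₂ r₁ ≫ r₂

/-- A morphism of internal preorders: a pair `(f, f')` commuting with the two projections. -/
@[ext]
structure InternalPreord.Hom {C : Type u} [Category.{v} C] [HasFiniteLimits C]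
    (A B : InternalPreord C) where
  onCarrier : A.carrier ⟶ B.carrier
  onRel : A.rel ⟶ B.rel
  onRel_r₁ : onRel ≫ B.r₁ = A.r₁ ≫ onCarrier
  onRel_r₂ : onRel ≫ B.r₂ = A.r₂ ≫ onCarrier

instance InternalPreord.instCategory {C : Type u} [Category.{v} C] [HasFiniteLimits C] :
    Category (InternalPreord C) where
  Hom A B := InternalPreord.Hom A B
  id A :=
    { onCarrier := 𝟙 _
      onRel := 𝟙 _
      onRel_r₁ := by simp
      onRel_r₂ := by simp }
  comp f g :=
    { onCarrier := f.onCarrier ≫ g.onCarrier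
      onRel := f.onRel ≫ g.onRel
      onRel_r₁ := by
        rw [Category.assoc, g.onRel_r₁, ← Category.assoc, f.onRel_r₁, Category.assoc]
      onRel_r₂ := by
        rw [Category.assoc, g.onRel_r₂, ← Category.assoc, f.onRel_r₂, Category.assoc] }
  id_comp f := InternalPreord.Hom.ext (Category.id_comp _) (Category.id_comp _)
  comp_id f := InternalPreord.Hom.ext (Category.comp_id _) (Category.comp_id _)
  assoc f g h := InternalPreord.Hom.ext (Category.assoc _ _ _) (Category.assoc _ _ _)

/-- An internal preorder `(A, ρ)` is antisymmetric when the intersection of `⟨r₁, r₂⟩` with its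
opposite `⟨r₂, r₁⟩` is the discrete relation `⟨1, 1⟩ : A ↣ A × A`. -/
def InternalPreord.isAntisymm (C : Type u) [Category.{v} C] [HasFiniteLimits C] :
    ObjectProperty (InternalPreord C) := fun A =>
  IsPullback A.refl A.refl (prod.lift A.r₁ A.r₂) (prod.lift A.r₂ A.r₁)

/-- The category of internal partial orders: the full subcategory of internal preorders on the
antisymmetric ones. -/
abbrev InternalParOrd (C : Type u) [Category.{v} C] [HasFiniteLimits C] :=
  (InternalPreord.isAntisymm C).FullSubcategory

/-- The inclusion `U` of internal partial orders into internal preorders. -/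
abbrev internalParOrdToPreord (C : Type u) [Category.{v} C] [HasFiniteLimits C] :
    InternalParOrd C ⥤ InternalPreord C :=
  (InternalPreord.isAntisymm C).ι

/-- The internal category of an internal preorder: its object of arrows is `ρ`. -/
def InternalPreord.toInternalCat {C : Type u} [Category.{v} C] [HasFiniteLimits C]
    (A : InternalPreord C) : InternalCat C where
  obj₀ := A.carrier
  arr := A.rel
  dom := A.r₁
  cod := A.r₂
  ident := A.refl
  comp := A.trans
  ident_dom := A.refl_r₁
  ident_cod := A.refl_r₂
  comp_dom := A.trans_r₁
  comp_cod := A.trans_r₂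
  ident_comp := A.jointlyMono.right_cancellation _ _
    (by simp [A.trans_r₁, A.refl_r₁, pullback.lift_fst_assoc])
    (by simp [A.trans_r₂, pullback.lift_snd_assoc])
  comp_ident := A.jointlyMono.right_cancellation _ _
    (by simp [A.trans_r₁, pullback.lift_fst_assoc])
    (by simp [A.trans_r₂, A.refl_r₂, pullback.lift_snd_assoc])
  assoc := A.jointlyMono.right_cancellation _ _
    (by simp [A.trans_r₁, pullback.lift_fst_assoc])
    (by simp [A.trans_r₂, pullback.lift_snd_assoc])

/-- The internal functor of a morphism of internal preorders. -/
def InternalPreord.Hom.toInternalFunctor {C : Type u} [Category.{v} C] [HasFiniteLimits C]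
    {A B : InternalPreord C} (f : InternalPreord.Hom A B) :
    InternalCat.Hom A.toInternalCat B.toInternalCat where
  onObj := f.onCarrier
  onArr := f.onRel
  onArr_dom := f.onRel_r₁
  onArr_cod := f.onRel_r₂
  ident_onArr := by
    change A.refl ≫ f.onRel = f.onCarrier ≫ B.refl
    apply B.jointlyMono.right_cancellation
    · simp [f.onRel_r₁, B.refl_r₁, reassoc_of% A.refl_r₁]
    · simp [f.onRel_r₂, B.refl_r₂, reassoc_of% A.refl_r₂]
  comp_onArr := by
    change A.trans ≫ f.onRel = pullback.map A.r₂ A.r₁ B.r₂ B.r₁ f.onRel f.onRel f.onCarrier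
      f.onRel_r₂.symm f.onRel_r₁.symm ≫ B.trans
    apply B.jointlyMono.right_cancellation
    · simp [f.onRel_r₁, B.trans_r₁, reassoc_of% A.trans_r₁, pullback.map,
        pullback.lift_fst_assoc]
    · simp [f.onRel_r₂, B.trans_r₂, reassoc_of% A.trans_r₂, pullback.map,
        pullback.lift_snd_assoc]

/-- The inclusion `V` of internal preorders into internal categories. -/
def internalPreordToCat (C : Type u) [Category.{v} C] [HasFiniteLimits C] :
    InternalPreord C ⥤ InternalCat C where
  obj A := A.toInternalCat
  map f := InternalPreord.Hom.toInternalFunctor f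
  map_id _ := rfl
  map_comp _ _ := rfl

/-- The inclusion `W = U V` of internal partial orders into internal categories. -/
abbrev internalParOrdToCat (C : Type u) [Category.{v} C] [HasFiniteLimits C] :
    InternalParOrd C ⥤ InternalCat C :=
  internalParOrdToPreord C ⋙ internalPreordToCat C

/-- A reflector `G`, left adjoint to the inclusion `V` of a reflective subcategory, has stable
units if it preserves every pullback of a unit component `X ⟶ V G X` along an arbitrary morphism
`φ : Y ⟶ V G X`. -/
def HasStableUnits {B : Type u₁} [Category.{v₁} B] {A : Type u₂} [Category.{v₂} A]
    {G : B ⥤ A} {V : A ⥤ B} (adj : G ⊣ V) : Prop :=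
  ∀ ⦃X Y P : B⦄ (p₁ : P ⟶ X) (p₂ : P ⟶ Y) (φ : Y ⟶ V.obj (G.obj X)),
    IsPullback p₁ p₂ (adj.unit.app X) φ →
      IsPullback (G.map p₁) (G.map p₂) (G.map (adj.unit.app X)) (G.map φ)

end

/-! The preorder reflection of an internal category keeps the objects and takes as order the image
of `⟨dom, cod⟩`. The partial order reflection divides a preorder by its symmetric part `ρ ∧ ρᵒ`.
That part is an equivalence relation, so exactness makes it the kernel pair of the quotient map
(`comp_quotπ_eq_iff`).

Hence the composite unit `η` of `X` is a strong epimorphism on objects and on arrows, and two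
objects of `X` with the same image are, after passing to a cover, joined by an arrow
(`isLocalQuotient_unit`). Now pull `η` back along `φ : Y ⟶ Q`, with projection `q : P ⟶ Y`. Strong
epimorphisms are stable under pullback, so `q` is one on objects and on arrows. If two objects of
`P` agree in `Y`, an arrow between their components in `X`, paired with an identity of `Y`, is an
arrow of `P`, since parallel arrows of the preorder `Q` are equal. So every functor from `P` to a
partial order sends them to elements that are comparable in both directions, hence equal, and it
factors uniquely through `q` (`IsLocalQuotient.bijective_of_isPullback`). By Yoneda the reflector
inverts `q`. It also inverts `η`, and a commutative square with these two opposite sides invertible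
is a pullback (`hasStableUnits_of_bijective`).

Arguments use generalized elements, with existence understood locally for strong epimorphisms. -/

theorem prodLift_eq_prodLift_iff {C : Type u} [Category.{v} C] [HasFiniteLimits C] {X Y T : C}
    {a c : T ⟶ X} {b d : T ⟶ Y} : prod.lift a b = prod.lift c d ↔ a = c ∧ b = d := by
  refine ⟨fun h => ⟨?_, ?_⟩, by rintro ⟨rfl, rfl⟩; rfl⟩
  · simpa only [prod.lift_fst] using congr($h ≫ prod.fst)
  · simpa only [prod.lift_snd] using congr($h ≫ prod.snd)

theorem mono_prodLift_of_jointlyMono₂ {C : Type u} [Category.{v} C] [HasFiniteLimits C]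
    {R X Y : C} {r₁ : R ⟶ X} {r₂ : R ⟶ Y}
    (h : JointlyMono₂ r₁ r₂) : Mono (prod.lift r₁ r₂) where
  right_cancellation f g hfg := by
    rw [prod.comp_lift, prod.comp_lift, prodLift_eq_prodLift_iff] at hfg
    exact h.right_cancellation f g hfg.1 hfg.2

/-! ### Strong epimorphisms as covers in a regular category. -/

section Regular

variable {C : Type u} [Category.{v} C] [Regular C]

/-- Strong epimorphisms in a regular category are stable under pullback. -/
theorem strongEpi_snd_of_isPullback {P X Y Z : C} {p : P ⟶ X} {q : P ⟶ Y} {f : X ⟶ Z} {g : Y ⟶ Z}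
    (h : IsPullback p q f g) [StrongEpi f] : StrongEpi q := by
  have : IsRegularEpi f := inferInstance
  have : IsRegularEpi q :=
    Regular.regularEpiIsStableUnderBaseChange.of_isPullback h
      ((MorphismProperty.regularEpi_iff f).2 this)
  infer_instance

/-- A generalized element of the codomain of a strong epimorphism lifts locally. -/
theorem exists_cover_lift {X Y T : C} (f : X ⟶ Y) [StrongEpi f] (y : T ⟶ Y) :
    ∃ (T' : C) (e : T' ⟶ T) (x : T' ⟶ X), StrongEpi e ∧ x ≫ f = e ≫ y :=
  ⟨_, pullback.snd f y, pullback.fst f y, strongEpi_snd_of_isPullback (.of_hasPullback f y),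
    pullback.condition⟩

theorem exists_cover_lift₂ {X Y T : C} (f : X ⟶ Y) [StrongEpi f] (y z : T ⟶ Y) :
    ∃ (T' : C) (e : T' ⟶ T) (x w : T' ⟶ X), StrongEpi e ∧ x ≫ f = e ≫ y ∧ w ≫ f = e ≫ z := by
  obtain ⟨T₁, e₁, x, _, hx⟩ := exists_cover_lift f y
  obtain ⟨T₂, e₂, w, _, hw⟩ := exists_cover_lift f (e₁ ≫ z)
  exact ⟨T₂, e₂ ≫ e₁, e₂ ≫ x, w, strongEpi_comp _ _, by simp [hx], by simp [hw]⟩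

/-- Membership in a relation is local for strong epimorphisms. -/
theorem JointlyMono₂.exists_lift_of_cover {R X Y T T' : C} {r₁ : R ⟶ X} {r₂ : R ⟶ Y}
    (h : JointlyMono₂ r₁ r₂) (e : T' ⟶ T) [StrongEpi e] {a : T ⟶ X} {b : T ⟶ Y} (t : T' ⟶ R)
    (h₁ : t ≫ r₁ = e ≫ a) (h₂ : t ≫ r₂ = e ≫ b) : ∃ s : T ⟶ R, s ≫ r₁ = a ∧ s ≫ r₂ = b := by
  have := mono_prodLift_of_jointlyMono₂ h
  -- The diagonal filler of the strong epimorphism `e` against the monomorphism `⟨r₁, r₂⟩` is the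
  -- required lift.
  have sq : CommSq t e (prod.lift r₁ r₂) (prod.lift a b) :=
    ⟨by rw [prod.comp_lift, prod.comp_lift, h₁, h₂]⟩
  have := sq.fac_right
  rw [prod.comp_lift, prodLift_eq_prodLift_iff] at this
  exact ⟨sq.lift, this⟩

end Regular

/-! ### Internal preorders through generalized elements. -/

namespace InternalPreord

variable {C : Type u} [Category.{v} C]

section

variable [HasFiniteLimits C] {A B : InternalPreord C}

/-- The order on generalized elements of an internal preorder. -/
def Le (A : InternalPreord C) {T : C} (a b : T ⟶ A.carrier) : Prop :=
  ∃ t : T ⟶ A.rel, t ≫ A.r₁ = a ∧ t ≫ A.r₂ = b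

theorem Le.rfl {T : C} (a : T ⟶ A.carrier) : A.Le a a :=
  ⟨a ≫ A.refl, by simp [A.refl_r₁], by simp [A.refl_r₂]⟩

theorem Le.trans {T : C} {a b c : T ⟶ A.carrier} (h : A.Le a b) (h' : A.Le b c) : A.Le a c := by
  obtain ⟨s, hs₁, hs₂⟩ := h
  obtain ⟨t, ht₁, ht₂⟩ := h'
  exact ⟨pullback.lift s t (hs₂.trans ht₁.symm) ≫ A.trans,
    by simp [A.trans_r₁, pullback.lift_fst_assoc, hs₁],
    by simp [A.trans_r₂, pullback.lift_snd_assoc, ht₂]⟩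

theorem Le.precomp {S T : C} (s : S ⟶ T) {a b : T ⟶ A.carrier} (h : A.Le a b) :
    A.Le (s ≫ a) (s ≫ b) := by
  obtain ⟨t, rfl, rfl⟩ := h
  exact ⟨s ≫ t, by simp, by simp⟩

theorem Le.map {T : C} (f : A ⟶ B) {a b : T ⟶ A.carrier} (h : A.Le a b) :
    B.Le (a ≫ f.onCarrier) (b ≫ f.onCarrier) := by
  obtain ⟨t, rfl, rfl⟩ := h
  exact ⟨t ≫ f.onRel, by simp [f.onRel_r₁], by simp [f.onRel_r₂]⟩

theorem r₁_le_r₂ (A : InternalPreord C) : A.Le A.r₁ A.r₂ := ⟨𝟙 _, by simp, by simp⟩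

/-- Morphisms of internal preorders are determined by their effect on carriers. -/
theorem hom_ext {f g : A ⟶ B} (h : f.onCarrier = g.onCarrier) : f = g :=
  Hom.ext h <| B.jointlyMono.right_cancellation _ _
    (by rw [f.onRel_r₁, g.onRel_r₁, h]) (by rw [f.onRel_r₂, g.onRel_r₂, h])

/-- A monotone morphism between carriers is a morphism of internal preorders. -/
noncomputable def homMk (f : A.carrier ⟶ B.carrier) (h : B.Le (A.r₁ ≫ f) (A.r₂ ≫ f)) : A ⟶ B where
  onCarrier := f
  onRel := h.choose
  onRel_r₁ := h.choose_spec.1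
  onRel_r₂ := h.choose_spec.2

/-- A generalized element of the intersection of `ρ` and its opposite is a pair of witnesses for `a
≤ b` and `b ≤ a`. This form allows antisymmetry to be used as for ordinary ordered sets. -/
theorem isAntisymm_iff : isAntisymm C A ↔
    ∀ ⦃T : C⦄ (a b : T ⟶ A.carrier), A.Le a b → A.Le b a → a = b := by
  constructor
  · intro h T a b ⟨s, hs₁, hs₂⟩ ⟨t, ht₁, ht₂⟩
    have hst : s ≫ prod.lift A.r₁ A.r₂ = t ≫ prod.lift A.r₂ A.r₁ := by
      rw [prod.comp_lift, prod.comp_lift, hs₁, hs₂, ht₁, ht₂]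
    have := IsPullback.lift_fst h s t hst
    rw [← hs₁, ← hs₂, ← this]
    simp [A.refl_r₁, A.refl_r₂]
  · intro h
    refine ⟨⟨by rw [prod.comp_lift, prod.comp_lift, A.refl_r₁, A.refl_r₂]⟩,
      ⟨PullbackCone.IsLimit.mk _ (fun s => s.fst ≫ A.r₁) (fun s => ?_) (fun s => ?_) (fun s m h₁ _ => ?_)⟩⟩
    all_goals
      have hs := s.condition
      rw [prod.comp_lift, prod.comp_lift, prodLift_eq_prodLift_iff] at hs
      obtain ⟨e₁, e₂⟩ := hs
      have e₃ : s.fst ≫ A.r₁ = s.fst ≫ A.r₂ :=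
        h _ _ ⟨s.fst, rfl, rfl⟩ ⟨s.snd, e₂.symm, e₁.symm⟩
    · exact A.jointlyMono.right_cancellation _ _ (by simp [A.refl_r₁]) (by simp [A.refl_r₂, e₃])
    · exact A.jointlyMono.right_cancellation _ _ (by simp [A.refl_r₁, ← e₂, ← e₃])
        (by simp [A.refl_r₂, ← e₁])
    · rw [← h₁]; simp [A.refl_r₁]

end

variable [Regular C]

/-- The order on generalized elements is local for strong epimorphisms. -/
theorem Le.of_cover {A : InternalPreord C} {T T' : C} (e : T' ⟶ T) [StrongEpi e]
    {a b : T ⟶ A.carrier} {a' b' : T' ⟶ A.carrier} (h : A.Le a' b') (ha : a' = e ≫ a)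
    (hb : b' = e ≫ b) : A.Le a b := by
  obtain ⟨t, h₁, h₂⟩ := h
  exact JointlyMono₂.exists_lift_of_cover A.jointlyMono e t (h₁.trans ha) (h₂.trans hb)

/-! ### The preorder generated by a span, as an image. -/

section OfSpan

variable {R X : C} (f g : R ⟶ X)

/-- The object of the relation on `X` which is the image of `⟨f, g⟩ : R ⟶ X × X`. -/
noncomputable def spanRel : C := (Regular.strongEpiMonoFactorisation (prod.lift f g)).I

/-- The projection of a span to the relation it generates. -/
noncomputable def spanRelπ : R ⟶ spanRel f g :=
  (Regular.strongEpiMonoFactorisation (prod.lift f g)).e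

/-- The relation generated by a span, as a subobject of the product. -/
noncomputable def spanRelι : spanRel f g ⟶ X ⨯ X :=
  (Regular.strongEpiMonoFactorisation (prod.lift f g)).m

/-- The first projection of the relation generated by a span. -/
noncomputable def spanRel₁ : spanRel f g ⟶ X := spanRelι f g ≫ prod.fst

/-- The second projection of the relation generated by a span. -/
noncomputable def spanRel₂ : spanRel f g ⟶ X := spanRelι f g ≫ prod.snd

instance strongEpi_spanRelπ : StrongEpi (spanRelπ f g) :=
  (Regular.strongEpiMonoFactorisation (prod.lift f g)).e_strong_epi

instance mono_spanRelι : Mono (spanRelι f g) :=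
  (Regular.strongEpiMonoFactorisation (prod.lift f g)).m_mono

theorem spanRelπ_comp_spanRelι : spanRelπ f g ≫ spanRelι f g = prod.lift f g :=
  (Regular.strongEpiMonoFactorisation (prod.lift f g)).fac

theorem spanRelπ_fst : spanRelπ f g ≫ spanRel₁ f g = f := by
  rw [spanRel₁, ← Category.assoc, spanRelπ_comp_spanRelι, prod.lift_fst]

theorem spanRelπ_snd : spanRelπ f g ≫ spanRel₂ f g = g := by
  rw [spanRel₂, ← Category.assoc, spanRelπ_comp_spanRelι, prod.lift_snd]

theorem jointlyMono₂_spanRel : JointlyMono₂ (spanRel₁ f g) (spanRel₂ f g) where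
  right_cancellation _ s t h₁ h₂ := by
    rw [← cancel_mono (spanRelι f g)]
    apply prod.hom_ext
    · rw [Category.assoc, Category.assoc]; exact h₁
    · rw [Category.assoc, Category.assoc]; exact h₂

variable {f g}

/-- Elements of the image lift to `R` only over a cover, where `htrans` composes them. The result
descends because the image is a relation, so the choice of `z` is immaterial. -/
theorem exists_spanRel_trans
    (htrans : ∀ ⦃T : C⦄ (x y : T ⟶ R), x ≫ g = y ≫ f → ∃ z, z ≫ f = x ≫ f ∧ z ≫ g = y ≫ g) :
    ∃ t : pullback (spanRel₂ f g) (spanRel₁ f g) ⟶ spanRel f g,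
      t ≫ spanRel₁ f g = pullback.fst (spanRel₂ f g) (spanRel₁ f g) ≫ spanRel₁ f g ∧
      t ≫ spanRel₂ f g = pullback.snd (spanRel₂ f g) (spanRel₁ f g) ≫ spanRel₂ f g := by
  obtain ⟨T, e, x, y, _, hx, hy⟩ := exists_cover_lift₂ (spanRelπ f g)
    (pullback.fst (spanRel₂ f g) (spanRel₁ f g)) (pullback.snd (spanRel₂ f g) (spanRel₁ f g))
  have hx₁ := congr($hx ≫ spanRel₁ f g)
  have hx₂ := congr($hx ≫ spanRel₂ f g)
  have hy₁ := congr($hy ≫ spanRel₁ f g)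
  have hy₂ := congr($hy ≫ spanRel₂ f g)
  rw [Category.assoc, Category.assoc, spanRelπ_fst] at hx₁ hy₁
  rw [Category.assoc, Category.assoc, spanRelπ_snd] at hx₂ hy₂
  obtain ⟨z, hz₁, hz₂⟩ := htrans x y (by rw [hx₂, hy₁, pullback.condition])
  exact JointlyMono₂.exists_lift_of_cover (jointlyMono₂_spanRel f g) e (z ≫ spanRelπ f g)
    (by rw [Category.assoc, spanRelπ_fst, hz₁, hx₁]) (by rw [Category.assoc, spanRelπ_snd, hz₂, hy₂])

/-- Reflexivity is asked only over a cover `e` because, for the antisymmetric quotient, the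
reflexivity witness lives on the original carrier and not on the quotient. -/
theorem exists_spanRel_refl {X' : C} (e : X' ⟶ X) [StrongEpi e] (r : X' ⟶ R)
    (h₁ : r ≫ f = e) (h₂ : r ≫ g = e) :
    ∃ t : X ⟶ spanRel f g, t ≫ spanRel₁ f g = 𝟙 X ∧ t ≫ spanRel₂ f g = 𝟙 X :=
  JointlyMono₂.exists_lift_of_cover (jointlyMono₂_spanRel f g) e (r ≫ spanRelπ f g)
    (by rw [Category.assoc, spanRelπ_fst, h₁, Category.comp_id])
    (by rw [Category.assoc, spanRelπ_snd, h₂, Category.comp_id])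

/-- The internal preorder generated by a span which is locally reflexive, and transitive on
generalized elements. -/
noncomputable def ofSpan (f g : R ⟶ X) {X' : C} (e : X' ⟶ X) [StrongEpi e] (r : X' ⟶ R)
    (h₁ : r ≫ f = e) (h₂ : r ≫ g = e)
    (htrans : ∀ ⦃T : C⦄ (x y : T ⟶ R), x ≫ g = y ≫ f → ∃ z, z ≫ f = x ≫ f ∧ z ≫ g = y ≫ g) :
    InternalPreord C where
  carrier := X
  rel := spanRel f g
  r₁ := spanRel₁ f g
  r₂ := spanRel₂ f g
  jointlyMono := jointlyMono₂_spanRel f g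
  refl := (exists_spanRel_refl e r h₁ h₂).choose
  refl_r₁ := (exists_spanRel_refl e r h₁ h₂).choose_spec.1
  refl_r₂ := (exists_spanRel_refl e r h₁ h₂).choose_spec.2
  trans := (exists_spanRel_trans htrans).choose
  trans_r₁ := (exists_spanRel_trans htrans).choose_spec.1
  trans_r₂ := (exists_spanRel_trans htrans).choose_spec.2

variable {X' : C} {e : X' ⟶ X} [StrongEpi e] {r : X' ⟶ R} {h₁ : r ≫ f = e} {h₂ : r ≫ g = e}
  {htrans : ∀ ⦃T : C⦄ (x y : T ⟶ R), x ≫ g = y ≫ f → ∃ z, z ≫ f = x ≫ f ∧ z ≫ g = y ≫ g}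

/-- This is the source of all local existence below: an inequality comes from an element of `R` only
after pulling back along the strong epimorphism `spanRelπ`. -/
theorem exists_cover_of_ofSpan_le {T : C} {a b : T ⟶ X}
    (h : (ofSpan f g e r h₁ h₂ htrans).Le a b) :
    ∃ (T' : C) (e : T' ⟶ T) (x : T' ⟶ R), StrongEpi e ∧ x ≫ f = e ≫ a ∧ x ≫ g = e ≫ b := by
  obtain ⟨t, h₁, h₂⟩ : ∃ t : T ⟶ spanRel f g, t ≫ spanRel₁ f g = a ∧ t ≫ spanRel₂ f g = b := h
  obtain ⟨T', e, x, he, hx⟩ := exists_cover_lift (spanRelπ f g) t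
  refine ⟨T', e, x, he, ?_, ?_⟩
  · rw [← h₁, ← Category.assoc, ← hx, Category.assoc, spanRelπ_fst]
  · rw [← h₂, ← Category.assoc, ← hx, Category.assoc, spanRelπ_snd]

/-- A morphism out of a preorder generated by a span is monotone as soon as it is so on the
span. -/
theorem ofSpan_le_of_span {B : InternalPreord C} (k : X ⟶ B.carrier) (h : B.Le (f ≫ k) (g ≫ k)) :
    B.Le ((ofSpan f g e r h₁ h₂ htrans).r₁ ≫ k) ((ofSpan f g e r h₁ h₂ htrans).r₂ ≫ k) :=
  h.of_cover (spanRelπ f g) ((reassoc_of% (spanRelπ_fst f g)) k).symm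
    ((reassoc_of% (spanRelπ_snd f g)) k).symm

end OfSpan

end InternalPreord

/-! ### Internal categories through generalized arrows. -/

namespace InternalCat

variable {C : Type u} [Category.{v} C] [HasFiniteLimits C] (A : InternalCat C)

/-- Composition of generalized arrows of an internal category. -/
noncomputable def mul {T : C} (f g : T ⟶ A.arr) (h : f ≫ A.cod = g ≫ A.dom) : T ⟶ A.arr :=
  pullback.lift f g h ≫ A.comp

variable {A}

theorem mul_dom {T : C} {f g : T ⟶ A.arr} (h : f ≫ A.cod = g ≫ A.dom) :
    A.mul f g h ≫ A.dom = f ≫ A.dom := by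
  rw [mul, Category.assoc, A.comp_dom, pullback.lift_fst_assoc]

theorem mul_cod {T : C} {f g : T ⟶ A.arr} (h : f ≫ A.cod = g ≫ A.dom) :
    A.mul f g h ≫ A.cod = g ≫ A.cod := by
  rw [mul, Category.assoc, A.comp_cod, pullback.lift_snd_assoc]

theorem mul_congr {T : C} {f f' g g' : T ⟶ A.arr} {h : f ≫ A.cod = g ≫ A.dom} (hf : f = f')
    (hg : g = g') : A.mul f g h = A.mul f' g' (hf ▸ hg ▸ h) := by
  subst hf hg; rfl

theorem comp_mul {S T : C} (s : S ⟶ T) {f g : T ⟶ A.arr} (h : f ≫ A.cod = g ≫ A.dom) :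
    s ≫ A.mul f g h = A.mul (s ≫ f) (s ≫ g) (by rw [Category.assoc, h, Category.assoc]) := by
  rw [mul, mul, ← Category.assoc]
  congr 1
  apply pullback.hom_ext <;> simp [pullback.lift_fst, pullback.lift_snd]

theorem mul_map {B : InternalCat C} (F : A ⟶ B) {T : C} {f g : T ⟶ A.arr}
    (h : f ≫ A.cod = g ≫ A.dom) :
    A.mul f g h ≫ F.onArr = B.mul (f ≫ F.onArr) (g ≫ F.onArr) (by
      rw [Category.assoc, F.onArr_cod, Category.assoc, F.onArr_dom, reassoc_of% h]) := by
  rw [mul, mul, Category.assoc, F.comp_onArr, ← Category.assoc]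
  congr 1
  apply pullback.hom_ext <;>
    simp [pullback.map, pullback.lift_fst, pullback.lift_snd, pullback.lift_fst_assoc,
      pullback.lift_snd_assoc]

theorem ident_mul {T : C} {a : T ⟶ A.obj₀} {f : T ⟶ A.arr}
    (h : (a ≫ A.ident) ≫ A.cod = f ≫ A.dom) : A.mul (a ≫ A.ident) f h = f := by
  have ha : a = f ≫ A.dom := by simpa [A.ident_cod] using h
  subst ha
  refine Eq.trans ?_ ((Category.assoc _ _ _).trans
    ((f ≫= A.ident_comp).trans (Category.comp_id f)))
  rw [mul]
  congr 1
  apply pullback.hom_ext <;> simp [pullback.lift_fst, pullback.lift_snd]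

theorem mul_ident {T : C} {a : T ⟶ A.obj₀} {f : T ⟶ A.arr}
    (h : f ≫ A.cod = (a ≫ A.ident) ≫ A.dom) : A.mul f (a ≫ A.ident) h = f := by
  have ha : f ≫ A.cod = a := by simpa [A.ident_dom] using h
  subst ha
  refine Eq.trans ?_ ((Category.assoc _ _ _).trans
    ((f ≫= A.comp_ident).trans (Category.comp_id f)))
  rw [mul]
  congr 1
  apply pullback.hom_ext <;> simp [pullback.lift_fst, pullback.lift_snd]

theorem mul_assoc {T : C} {f g k : T ⟶ A.arr} (h : f ≫ A.cod = g ≫ A.dom)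
    (h' : g ≫ A.cod = k ≫ A.dom) :
    A.mul (A.mul f g h) k (by rw [mul_cod, h']) = A.mul f (A.mul g k h') (by rw [mul_dom, h]) := by
  -- Associativity is evaluated at the generalized triple `((f, g), (g, k))`.
  have := pullback.lift (f := pullback.snd A.cod A.dom) (g := pullback.fst A.cod A.dom)
    (pullback.lift f g h) (pullback.lift g k h')
    (by rw [pullback.lift_snd, pullback.lift_fst]) ≫= A.assoc
  refine Eq.trans ?_ ((Category.assoc _ _ _).trans
    (this.trans ((Category.assoc _ _ _).symm.trans ?_)))
  all_goals
    simp only [mul]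
    congr 1
    apply pullback.hom_ext <;>
      simp [pullback.lift_fst, pullback.lift_snd, pullback.lift_fst_assoc,
        pullback.lift_snd_assoc]

/-- An internal category from the composition of its generalized arrows. -/
noncomputable def ofMul (obj₀ arr : C) (dom cod : arr ⟶ obj₀) (ident : obj₀ ⟶ arr)
    (ident_dom : ident ≫ dom = 𝟙 obj₀) (ident_cod : ident ≫ cod = 𝟙 obj₀)
    (m : ∀ ⦃T : C⦄ (f g : T ⟶ arr), f ≫ cod = g ≫ dom → (T ⟶ arr))
    (comp_m : ∀ ⦃S T : C⦄ (s : S ⟶ T) (f g : T ⟶ arr) (h : f ≫ cod = g ≫ dom)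
      (h' : (s ≫ f) ≫ cod = (s ≫ g) ≫ dom), s ≫ m f g h = m (s ≫ f) (s ≫ g) h')
    (m_dom : ∀ ⦃T : C⦄ (f g : T ⟶ arr) (h : f ≫ cod = g ≫ dom), m f g h ≫ dom = f ≫ dom)
    (m_cod : ∀ ⦃T : C⦄ (f g : T ⟶ arr) (h : f ≫ cod = g ≫ dom), m f g h ≫ cod = g ≫ cod)
    (ident_m : ∀ (h : (dom ≫ ident) ≫ cod = 𝟙 arr ≫ dom), m (dom ≫ ident) (𝟙 arr) h = 𝟙 arr)
    (m_ident : ∀ (h : 𝟙 arr ≫ cod = (cod ≫ ident) ≫ dom), m (𝟙 arr) (cod ≫ ident) h = 𝟙 arr)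
    (m_assoc : ∀ ⦃T : C⦄ (f g k : T ⟶ arr) (h : f ≫ cod = g ≫ dom) (h' : g ≫ cod = k ≫ dom)
      (h₁ : m f g h ≫ cod = k ≫ dom) (h₂ : f ≫ cod = m g k h' ≫ dom),
      m (m f g h) k h₁ = m f (m g k h') h₂) : InternalCat C where
  obj₀ := obj₀
  arr := arr
  dom := dom
  cod := cod
  ident := ident
  comp := m (pullback.fst cod dom) (pullback.snd cod dom) pullback.condition
  ident_dom := ident_dom
  ident_cod := ident_cod
  comp_dom := m_dom _ _ _
  comp_cod := m_cod _ _ _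
  ident_comp := by
    rw [comp_m _ _ _ _ (by simp only [pullback.lift_fst, pullback.lift_snd]; simp [ident_cod])]
    simp only [pullback.lift_fst, pullback.lift_snd, ident_m]
  comp_ident := by
    rw [comp_m _ _ _ _ (by simp only [pullback.lift_fst, pullback.lift_snd]; simp [ident_dom])]
    simp only [pullback.lift_fst, pullback.lift_snd, m_ident]
  assoc := by
    have m_congr : ∀ {T : C} {f f' g g' : T ⟶ arr} (h : f ≫ cod = g ≫ dom)
        (h' : f' ≫ cod = g' ≫ dom), f = f' → g = g' → m f g h = m f' g' h' := by
      rintro T f _ g _ h h' rfl rfl; rfl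
    -- A composable triple is a pair of composable pairs; `w` identifies the two copies of its
    -- middle arrow.
    have w := pullback.condition (f := pullback.snd cod dom) (g := pullback.fst cod dom)
    have w' := pullback.condition (f := cod) (g := dom)
    have h₁ : (pullback.fst (pullback.snd cod dom) (pullback.fst cod dom) ≫
        pullback.fst cod dom) ≫ cod = (pullback.fst (pullback.snd cod dom) (pullback.fst cod dom) ≫
        pullback.snd cod dom) ≫ dom := by simp [w']
    have h₂ : (pullback.snd (pullback.snd cod dom) (pullback.fst cod dom) ≫
        pullback.fst cod dom) ≫ cod = (pullback.snd (pullback.snd cod dom) (pullback.fst cod dom) ≫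
        pullback.snd cod dom) ≫ dom := by simp [w']
    have h₃ := h₂
    rw [← w] at h₃
    have e₁ := comp_m _ _ _ w' h₁
    have e₂ := (comp_m _ _ _ w' h₂).trans (m_congr _ h₃ w.symm rfl)
    refine (comp_m _ _ _ w' ?_).trans ((m_congr _ ?_ ((pullback.lift_fst ..).trans e₁)
      (pullback.lift_snd ..)).trans ((m_assoc _ _ _ h₁ h₃ ?_ ?_).trans
      ((comp_m _ _ _ w' ?_).trans (m_congr _ ?_ (pullback.lift_fst ..)
        ((pullback.lift_snd ..).trans e₂))).symm))
    · simp [w']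
    · rw [m_cod, h₃]
    · rw [m_cod, h₃]
    · rw [m_dom, h₁]
    · simp [w']
    · rw [m_dom, h₁]

variable (B : InternalPreord C)

/-- Internal functors into an internal preorder are determined by their effect on objects. -/
theorem hom_ext_toPreord {F G : A ⟶ B.toInternalCat} (h : F.onObj = G.onObj) : F = G :=
  Hom.ext h <| B.jointlyMono.right_cancellation _ _
    (F.onArr_dom.trans (h ▸ G.onArr_dom.symm)) (F.onArr_cod.trans (h ▸ G.onArr_cod.symm))

variable {B}

/-- The order between the endpoints of a generalized arrow, under an internal functor into an
internal preorder. -/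
theorem le_of_arrow (F : A ⟶ B.toInternalCat) {T : C} (x : T ⟶ A.arr) {a b : T ⟶ A.obj₀}
    (ha : x ≫ A.dom = a) (hb : x ≫ A.cod = b) : B.Le (a ≫ F.onObj) (b ≫ F.onObj) := by
  subst ha hb
  exact ⟨x ≫ F.onArr,
    (Category.assoc _ _ _).trans ((x ≫= F.onArr_dom).trans (Category.assoc _ _ _).symm),
    (Category.assoc _ _ _).trans ((x ≫= F.onArr_cod).trans (Category.assoc _ _ _).symm)⟩

/-- A monotone morphism on objects is an internal functor into an internal preorder. -/
noncomputable def homToPreord (f : A.obj₀ ⟶ B.carrier) (t : A.arr ⟶ B.rel)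
    (h₁ : t ≫ B.r₁ = A.dom ≫ f) (h₂ : t ≫ B.r₂ = A.cod ≫ f) : A ⟶ B.toInternalCat where
  onObj := f
  onArr := t
  onArr_dom := h₁
  onArr_cod := h₂
  ident_onArr := B.jointlyMono.right_cancellation _ _
    (by
      change (A.ident ≫ t) ≫ B.r₁ = (f ≫ B.refl) ≫ B.r₁
      rw [Category.assoc, h₁, reassoc_of% A.ident_dom, Category.assoc, B.refl_r₁,
        Category.comp_id])
    (by
      change (A.ident ≫ t) ≫ B.r₂ = (f ≫ B.refl) ≫ B.r₂
      rw [Category.assoc, h₂, reassoc_of% A.ident_cod, Category.assoc, B.refl_r₂,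
        Category.comp_id])
  comp_onArr := B.jointlyMono.right_cancellation _ _
    (by
      change (A.comp ≫ t) ≫ B.r₁ = (pullback.map A.cod A.dom B.r₂ B.r₁ t t f h₂.symm h₁.symm ≫
        B.trans) ≫ B.r₁
      simp [h₁, reassoc_of% A.comp_dom, B.trans_r₁, pullback.map, pullback.lift_fst_assoc])
    (by
      change (A.comp ≫ t) ≫ B.r₂ = (pullback.map A.cod A.dom B.r₂ B.r₁ t t f h₂.symm h₁.symm ≫
        B.trans) ≫ B.r₂
      simp [h₂, reassoc_of% A.comp_cod, B.trans_r₂, pullback.map, pullback.lift_snd_assoc])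

end InternalCat

/-! ### The reflection of internal categories onto preorders. -/

section Reflections

variable (C : Type u) [Category.{v} C]

instance [HasFiniteLimits C] : (internalPreordToCat C).Full where
  map_surjective F := ⟨⟨F.onObj, F.onArr, F.onArr_dom, F.onArr_cod⟩, rfl⟩

instance [HasFiniteLimits C] : (internalPreordToCat C).Faithful where
  map_injective h := InternalPreord.hom_ext congr(($h).onObj)

variable {C} [Regular C]

namespace InternalCat

/-- The preorder reflection of an internal category, on the same object of objects. -/
noncomputable def preord (A : InternalCat C) : InternalPreord C :=
  .ofSpan A.dom A.cod (𝟙 A.obj₀) A.ident A.ident_dom A.ident_cod fun _ x y h =>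
    ⟨A.mul x y h, mul_dom h, mul_cod h⟩

theorem exists_arrow_of_preord_le (A : InternalCat C) {T : C} {a b : T ⟶ A.obj₀}
    (h : A.preord.Le a b) : ∃ (T' : C) (e : T' ⟶ T) (x : T' ⟶ A.arr), StrongEpi e ∧
      x ≫ A.dom = e ≫ a ∧ x ≫ A.cod = e ≫ b :=
  InternalPreord.exists_cover_of_ofSpan_le h

/-- The unit of the preorder reflection. -/
noncomputable def toPreord (A : InternalCat C) : A ⟶ A.preord.toInternalCat :=
  homToPreord (𝟙 A.obj₀) (InternalPreord.spanRelπ A.dom A.cod)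
    ((InternalPreord.spanRelπ_fst _ _).trans (Category.comp_id _).symm)
    ((InternalPreord.spanRelπ_snd _ _).trans (Category.comp_id _).symm)

/-- The unit is the identity on objects, which determine a functor into a preorder. Monotonicity for
the image order needs checking only on the arrows of `A`. -/
theorem toPreord_bijective (A : InternalCat C) (B : InternalPreord C) :
    Function.Bijective fun f : A.preord ⟶ B => A.toPreord ≫ (internalPreordToCat C).map f := by
  refine ⟨fun f g h => InternalPreord.hom_ext ?_, fun F => ?_⟩
  · have : 𝟙 _ ≫ f.onCarrier = 𝟙 _ ≫ g.onCarrier := congr(($h).onObj)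
    rwa [Category.id_comp, Category.id_comp] at this
  · refine ⟨InternalPreord.homMk F.onObj (InternalPreord.ofSpan_le_of_span _ ?_),
      hom_ext_toPreord B (Category.id_comp _)⟩
    exact ⟨F.onArr, F.onArr_dom, F.onArr_cod⟩

end InternalCat

/-- The preorder reflection of internal categories. -/
noncomputable def internalPreordAdjunction :=
  Adjunction.adjunctionOfEquivLeft (G := internalPreordToCat C) (F_obj := InternalCat.preord)
    (fun A B => Equiv.ofBijective _ (A.toPreord_bijective B)) fun A _ _ _ _ =>
      (A.toPreord ≫= Functor.map_comp _ _ _).trans (Category.assoc _ _ _).symm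

theorem internalPreordAdjunction_unit_app (A : InternalCat C) :
    internalPreordAdjunction.unit.app A = A.toPreord := by
  simp [internalPreordAdjunction, Adjunction.adjunctionOfEquivLeft]
  exact Category.comp_id _

end Reflections

/-! ### The reflection of preorders onto partial orders. -/

namespace InternalPreord

variable {C : Type u} [Category.{v} C]

section Symmetrization

variable [HasFiniteLimits C] (A : InternalPreord C)

/-- The object of the intersection of an internal preorder with its opposite. -/
noncomputable def symmRel : C := pullback (prod.lift A.r₁ A.r₂) (prod.lift A.r₂ A.r₁)

/-- The first projection of the intersection of an internal preorder with its opposite. -/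
noncomputable def symmRel₁ : A.symmRel ⟶ A.carrier :=
  pullback.fst (prod.lift A.r₁ A.r₂) (prod.lift A.r₂ A.r₁) ≫ A.r₁

/-- The second projection of the intersection of an internal preorder with its opposite. -/
noncomputable def symmRel₂ : A.symmRel ⟶ A.carrier :=
  pullback.fst (prod.lift A.r₁ A.r₂) (prod.lift A.r₂ A.r₁) ≫ A.r₂

variable {A}

theorem exists_symmRel_iff {T : C} {a b : T ⟶ A.carrier} :
    (∃ t, t ≫ A.symmRel₁ = a ∧ t ≫ A.symmRel₂ = b) ↔ A.Le a b ∧ A.Le b a := by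
  constructor
  · rintro ⟨t, rfl, rfl⟩
    have h := pullback.condition (f := prod.lift A.r₁ A.r₂) (g := prod.lift A.r₂ A.r₁)
    rw [prod.comp_lift, prod.comp_lift, prodLift_eq_prodLift_iff] at h
    exact ⟨⟨t ≫ pullback.fst _ _, Category.assoc _ _ _, Category.assoc _ _ _⟩,
      ⟨t ≫ pullback.snd _ _, (Category.assoc _ _ _).trans (t ≫= h.2.symm),
        (Category.assoc _ _ _).trans (t ≫= h.1.symm)⟩⟩
  · rintro ⟨⟨s, h₁, h₂⟩, t, h₃, h₄⟩
    refine ⟨pullback.lift s t ?_, ?_, ?_⟩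
    · rw [prod.comp_lift, prod.comp_lift, h₁, h₂, h₃, h₄]
    · exact (pullback.lift_fst_assoc ..).trans h₁
    · exact (pullback.lift_fst_assoc ..).trans h₂

variable (A) in
theorem jointlyMono₂_symmRel : JointlyMono₂ A.symmRel₁ A.symmRel₂ where
  right_cancellation T s t h₁ h₂ := by
    have h : s ≫ pullback.fst (prod.lift A.r₁ A.r₂) (prod.lift A.r₂ A.r₁) =
        t ≫ pullback.fst (prod.lift A.r₁ A.r₂) (prod.lift A.r₂ A.r₁) :=
      A.jointlyMono.right_cancellation _ _
        ((Category.assoc _ _ _).trans (h₁.trans (Category.assoc _ _ _).symm))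
        ((Category.assoc _ _ _).trans (h₂.trans (Category.assoc _ _ _).symm))
    -- The opposite relation is monic too, hence so is its pullback `pullback.fst`.
    have : Mono (prod.lift A.r₂ A.r₁) := mono_prodLift_of_jointlyMono₂
      ⟨fun _ f g h h' => A.jointlyMono.right_cancellation f g h' h⟩
    exact (cancel_mono (pullback.fst (prod.lift A.r₁ A.r₂) (prod.lift A.r₂ A.r₁))).1 h

theorem symmRel_le : A.Le A.symmRel₁ A.symmRel₂ ∧ A.Le A.symmRel₂ A.symmRel₁ :=
  exists_symmRel_iff.1 ⟨𝟙 _, by simp, by simp⟩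

variable (A) in
theorem isEquivalenceRelation_symmRel : IsEquivalenceRelation A.symmRel₁ A.symmRel₂ := by
  obtain ⟨r, hr₁, hr₂⟩ := exists_symmRel_iff.2 ⟨Le.rfl (𝟙 A.carrier), Le.rfl (𝟙 A.carrier)⟩
  obtain ⟨s, hs₁, hs₂⟩ := exists_symmRel_iff.2 A.symmRel_le.symm
  have h := symmRel_le (A := A)
  have w := pullback.condition (f := A.symmRel₂) (g := A.symmRel₁)
  obtain ⟨t, ht₁, ht₂⟩ : ∃ t, t ≫ A.symmRel₁ = pullback.fst A.symmRel₂ A.symmRel₁ ≫ A.symmRel₁ ∧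
      t ≫ A.symmRel₂ = pullback.snd A.symmRel₂ A.symmRel₁ ≫ A.symmRel₂ := by
    refine exists_symmRel_iff.2 ⟨(h.1.precomp _).trans (w ▸ h.1.precomp _),
      (h.2.precomp _).trans (w ▸ h.2.precomp _)⟩
  exact ⟨⟨{
    toJointlyMono₂ := jointlyMono₂_symmRel A
    r := r
    reflexivity₁ := hr₁
    reflexivity₂ := hr₂
    s := s
    symmetry₁ := hs₁
    symmetry₂ := hs₂
    c := _
    isLimit := pullbackIsPullback A.symmRel₂ A.symmRel₁
    t := t
    transitivity₁ := ht₁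
    transitivity₂ := ht₂ }⟩⟩

end Symmetrization

variable [BarrExact C] (A : InternalPreord C)

/-- By exactness the symmetric part is a kernel pair, and kernel pairs have coequalizers in a
regular category. -/
instance hasCoequalizer_symmRel : HasCoequalizer A.symmRel₁ A.symmRel₂ := by
  obtain ⟨_, _, hf⟩ := BarrExact.effective _ _ A.isEquivalenceRelation_symmRel
  exact Regular.hasCoequalizer_of_isKernelPair hf

/-- The carrier of the antisymmetric quotient of an internal preorder. -/
noncomputable def quot : C := coequalizer A.symmRel₁ A.symmRel₂

/-- The projection to the antisymmetric quotient of an internal preorder. -/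
noncomputable def quotπ : A.carrier ⟶ A.quot := coequalizer.π A.symmRel₁ A.symmRel₂

instance : IsRegularEpi A.quotπ := inferInstanceAs (IsRegularEpi (coequalizer.π _ _))

variable {A}

/-- Exactness gives some `f` with kernel pair `symmRel`. As `f` factors through the coequalizer
`quotπ`, whatever `quotπ` identifies is identified by `f`, hence lies in the symmetric part. -/
theorem comp_quotπ_eq_iff {T : C} {a b : T ⟶ A.carrier} :
    a ≫ A.quotπ = b ≫ A.quotπ ↔ A.Le a b ∧ A.Le b a := by
  rw [← exists_symmRel_iff]
  constructor
  · intro h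
    obtain ⟨Y, f, hf⟩ := BarrExact.effective _ _ A.isEquivalenceRelation_symmRel
    have w : A.quotπ ≫ coequalizer.desc f hf.w = f := coequalizer.π_desc _ _
    have hab : a ≫ f = b ≫ f := by
      rw [← w]
      exact (Category.assoc _ _ _).symm.trans ((h =≫ _).trans (Category.assoc _ _ _))
    exact ⟨hf.lift a b hab, hf.lift_fst _ _ _, hf.lift_snd _ _ _⟩
  · rintro ⟨t, rfl, rfl⟩
    rw [Category.assoc, Category.assoc]
    exact t ≫= coequalizer.condition _ _

theorem Le.comp_quotπ_eq {T : C} {a b c d : T ⟶ A.carrier} (h : A.Le a b)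
    (hac : a ≫ A.quotπ = c ≫ A.quotπ) (hbd : b ≫ A.quotπ = d ≫ A.quotπ) : A.Le c d :=
  (comp_quotπ_eq_iff.1 hac).2.trans (h.trans (comp_quotπ_eq_iff.1 hbd).1)

variable (A)

/-- The antisymmetric quotient of an internal preorder, as an internal preorder. -/
noncomputable def antisymm : InternalPreord C :=
  .ofSpan (A.r₁ ≫ A.quotπ) (A.r₂ ≫ A.quotπ) A.quotπ A.refl
    (by rw [← Category.assoc, A.refl_r₁, Category.id_comp])
    (by rw [← Category.assoc, A.refl_r₂, Category.id_comp]) fun T x y h => by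
      rw [← Category.assoc, ← Category.assoc] at h
      -- The target of `x` and the source of `y` agree only in the quotient; the inequality between
      -- them supplied by `comp_quotπ_eq_iff` bridges the gap.
      obtain ⟨z, hz₁, hz₂⟩ := (A.r₁_le_r₂.precomp x).trans
        ((comp_quotπ_eq_iff.1 h).1.trans (A.r₁_le_r₂.precomp y))
      exact ⟨z, by rw [← Category.assoc, hz₁, Category.assoc],
        by rw [← Category.assoc, hz₂, Category.assoc]⟩

/-- The projection of an internal preorder to its antisymmetric quotient. -/
noncomputable def toAntisymm : A ⟶ A.antisymm where
  onCarrier := A.quotπ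
  onRel := spanRelπ (A.r₁ ≫ A.quotπ) (A.r₂ ≫ A.quotπ)
  onRel_r₁ := spanRelπ_fst _ _
  onRel_r₂ := spanRelπ_snd _ _

/-- Over a common cover, `x` witnesses `a ≤ b` and `y` witnesses `b ≤ a` by representatives in `A`.
The endpoints of `y` are equivalent to those of `x` in reverse order, so the endpoints of `x` are
comparable both ways and become equal in the quotient. -/
theorem isAntisymm_antisymm : isAntisymm C A.antisymm := by
  rw [isAntisymm_iff]
  intro T a b hab hba
  obtain ⟨T₁, e₁, x, _, hx₁, hx₂⟩ := exists_cover_of_ofSpan_le hab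
  obtain ⟨T₂, e₂, y, _, hy₁, hy₂⟩ := exists_cover_of_ofSpan_le (hba.precomp e₁)
  rw [← Category.assoc] at hx₁ hx₂ hy₁ hy₂
  have h : (e₂ ≫ x) ≫ A.r₁ ≫ A.quotπ = (e₂ ≫ x) ≫ A.r₂ ≫ A.quotπ := by
    rw [← Category.assoc, ← Category.assoc, comp_quotπ_eq_iff]
    refine ⟨A.r₁_le_r₂.precomp _, (A.r₁_le_r₂.precomp y).comp_quotπ_eq ?_ ?_⟩
    · rw [hy₁, Category.assoc e₂, Category.assoc e₂, hx₂]; rfl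
    · rw [hy₂, Category.assoc e₂, Category.assoc e₂, hx₁]; rfl
  rw [Category.assoc, Category.assoc, ← Category.assoc x, ← Category.assoc x, hx₁, hx₂] at h
  exact (cancel_epi e₁).1 ((cancel_epi e₂).1 h)

/-- A monotone map to an antisymmetric `B` equalizes the symmetric part, so it descends to the
coequalizer; monotonicity of the descended map is tested on the generating span. -/
theorem toAntisymm_bijective {B : InternalPreord C} (hB : isAntisymm C B) :
    Function.Bijective fun f : A.antisymm ⟶ B => A.toAntisymm ≫ f := by
  refine ⟨fun f g h => hom_ext ?_, fun F => ?_⟩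
  · have : A.quotπ ≫ f.onCarrier = A.quotπ ≫ g.onCarrier := congr(($h).onCarrier)
    exact (cancel_epi A.quotπ).1 this
  · let k : A.quot ⟶ B.carrier := coequalizer.desc F.onCarrier
      (isAntisymm_iff.1 hB _ _ (symmRel_le.1.map F) (symmRel_le.2.map F))
    have hk : A.quotπ ≫ k = F.onCarrier := coequalizer.π_desc _ _
    refine ⟨homMk k (ofSpan_le_of_span k ?_), hom_ext hk⟩
    rw [Category.assoc, Category.assoc, hk]
    exact A.r₁_le_r₂.map F

/-- The antisymmetric quotient of an internal preorder, as an internal partial order. -/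
noncomputable def parOrd : InternalParOrd C := ⟨A.antisymm, A.isAntisymm_antisymm⟩

theorem parOrd_bijective (B : InternalParOrd C) :
    Function.Bijective fun f : A.parOrd ⟶ B =>
      A.toAntisymm ≫ (internalParOrdToPreord C).map f :=
  (A.toAntisymm_bijective B.property).comp
    ⟨fun _ _ h => InducedCategory.hom_ext h, fun f => ⟨⟨f⟩, rfl⟩⟩

end InternalPreord

variable {C : Type u} [Category.{v} C] [BarrExact C]

/-- The partial order reflection of internal preorders. -/
noncomputable def internalParOrdAdjunction :=
  Adjunction.adjunctionOfEquivLeft (G := internalParOrdToPreord C)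
    (F_obj := InternalPreord.parOrd)
    (fun A B => Equiv.ofBijective _ (A.parOrd_bijective B)) fun A _ _ _ _ =>
      (A.toAntisymm ≫= Functor.map_comp _ _ _).trans (Category.assoc _ _ _).symm

theorem internalParOrdAdjunction_unit_app (A : InternalPreord C) :
    internalParOrdAdjunction.unit.app A = A.toAntisymm := by
  simp [internalParOrdAdjunction, Adjunction.adjunctionOfEquivLeft]
  exact Category.comp_id _

/-! ### Pullbacks of internal categories, computed componentwise. -/

namespace InternalCat

variable {C : Type u} [Category.{v} C] [HasFiniteLimits C] {X Y Z : InternalCat C}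
  (F : X ⟶ Z) (G : Y ⟶ Z)

/-- The domain of the pullback of two internal functors. -/
noncomputable def pullbackDom : pullback F.onArr G.onArr ⟶ pullback F.onObj G.onObj :=
  pullback.map _ _ _ _ X.dom Y.dom Z.dom F.onArr_dom G.onArr_dom

/-- The codomain of the pullback of two internal functors. -/
noncomputable def pullbackCod : pullback F.onArr G.onArr ⟶ pullback F.onObj G.onObj :=
  pullback.map _ _ _ _ X.cod Y.cod Z.cod F.onArr_cod G.onArr_cod

/-- The identities of the pullback of two internal functors. -/
noncomputable def pullbackIdent : pullback F.onObj G.onObj ⟶ pullback F.onArr G.onArr :=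
  pullback.map _ _ _ _ X.ident Y.ident Z.ident F.ident_onArr.symm G.ident_onArr.symm

theorem pullbackDom_fst : pullbackDom F G ≫ pullback.fst _ _ = pullback.fst _ _ ≫ X.dom :=
  pullback.lift_fst ..

theorem pullbackDom_snd : pullbackDom F G ≫ pullback.snd _ _ = pullback.snd _ _ ≫ Y.dom :=
  pullback.lift_snd ..

theorem pullbackCod_fst : pullbackCod F G ≫ pullback.fst _ _ = pullback.fst _ _ ≫ X.cod :=
  pullback.lift_fst ..

theorem pullbackCod_snd : pullbackCod F G ≫ pullback.snd _ _ = pullback.snd _ _ ≫ Y.cod :=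
  pullback.lift_snd ..

theorem pullbackIdent_fst :
    pullbackIdent F G ≫ pullback.fst _ _ = pullback.fst _ _ ≫ X.ident :=
  pullback.lift_fst ..

theorem pullbackIdent_snd :
    pullbackIdent F G ≫ pullback.snd _ _ = pullback.snd _ _ ≫ Y.ident :=
  pullback.lift_snd ..

variable {F G}

section Mul

variable {T : C} {f g : T ⟶ pullback F.onArr G.onArr}

theorem pullback_composable_fst (h : f ≫ pullbackCod F G = g ≫ pullbackDom F G) :
    (f ≫ pullback.fst _ _) ≫ X.cod = (g ≫ pullback.fst _ _) ≫ X.dom := by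
  rw [Category.assoc, ← pullbackCod_fst, Category.assoc, ← pullbackDom_fst, reassoc_of% h]

theorem pullback_composable_snd (h : f ≫ pullbackCod F G = g ≫ pullbackDom F G) :
    (f ≫ pullback.snd _ _) ≫ Y.cod = (g ≫ pullback.snd _ _) ≫ Y.dom := by
  rw [Category.assoc, ← pullbackCod_snd, Category.assoc, ← pullbackDom_snd, reassoc_of% h]

/-- Composition of generalized arrows in the pullback of two internal functors. -/
noncomputable def pullbackMul (f g : T ⟶ pullback F.onArr G.onArr)
    (h : f ≫ pullbackCod F G = g ≫ pullbackDom F G) : T ⟶ pullback F.onArr G.onArr :=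
  pullback.lift (X.mul _ _ (pullback_composable_fst h)) (Y.mul _ _ (pullback_composable_snd h)) (by
    rw [mul_map, mul_map]
    apply mul_congr <;> rw [Category.assoc, pullback.condition, Category.assoc])

theorem pullbackMul_fst (h : f ≫ pullbackCod F G = g ≫ pullbackDom F G) :
    pullbackMul f g h ≫ pullback.fst _ _ = X.mul _ _ (pullback_composable_fst h) :=
  pullback.lift_fst ..

theorem pullbackMul_snd (h : f ≫ pullbackCod F G = g ≫ pullbackDom F G) :
    pullbackMul f g h ≫ pullback.snd _ _ = Y.mul _ _ (pullback_composable_snd h) :=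
  pullback.lift_snd ..

end Mul

variable (F G)

/-- The pullback of two internal functors, formed componentwise. -/
noncomputable def pullbackObj : InternalCat C :=
  .ofMul (pullback F.onObj G.onObj) (pullback F.onArr G.onArr) (pullbackDom F G) (pullbackCod F G)
    (pullbackIdent F G)
    (by
      apply pullback.hom_ext
      · rw [Category.assoc, pullbackDom_fst, ← Category.assoc, pullbackIdent_fst, Category.assoc,
          X.ident_dom, Category.comp_id, Category.id_comp]
      · rw [Category.assoc, pullbackDom_snd, ← Category.assoc, pullbackIdent_snd, Category.assoc,
          Y.ident_dom, Category.comp_id, Category.id_comp])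
    (by
      apply pullback.hom_ext
      · rw [Category.assoc, pullbackCod_fst, ← Category.assoc, pullbackIdent_fst, Category.assoc,
          X.ident_cod, Category.comp_id, Category.id_comp]
      · rw [Category.assoc, pullbackCod_snd, ← Category.assoc, pullbackIdent_snd, Category.assoc,
          Y.ident_cod, Category.comp_id, Category.id_comp])
    (fun _ f g h => pullbackMul f g h)
    (fun _ _ s f g h h' => by
      apply pullback.hom_ext
      · rw [Category.assoc, pullbackMul_fst, pullbackMul_fst, comp_mul]
        exact mul_congr (Category.assoc _ _ _).symm (Category.assoc _ _ _).symm
      · rw [Category.assoc, pullbackMul_snd, pullbackMul_snd, comp_mul]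
        exact mul_congr (Category.assoc _ _ _).symm (Category.assoc _ _ _).symm)
    (fun _ f g h => by
      apply pullback.hom_ext
      · rw [Category.assoc, Category.assoc, pullbackDom_fst, ← Category.assoc, pullbackMul_fst,
          mul_dom, Category.assoc]
      · rw [Category.assoc, Category.assoc, pullbackDom_snd, ← Category.assoc, pullbackMul_snd,
          mul_dom, Category.assoc])
    (fun _ f g h => by
      apply pullback.hom_ext
      · rw [Category.assoc, Category.assoc, pullbackCod_fst, ← Category.assoc, pullbackMul_fst,
          mul_cod, Category.assoc]
      · rw [Category.assoc, Category.assoc, pullbackCod_snd, ← Category.assoc, pullbackMul_snd,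
          mul_cod, Category.assoc])
    (fun h => by
      apply pullback.hom_ext
      · rw [pullbackMul_fst, mul_congr (f' := (pullback.fst _ _ ≫ X.dom) ≫ X.ident) (by
          rw [Category.assoc, pullbackIdent_fst, ← Category.assoc, pullbackDom_fst]) rfl, ident_mul]
      · rw [pullbackMul_snd, mul_congr (f' := (pullback.snd _ _ ≫ Y.dom) ≫ Y.ident) (by
          rw [Category.assoc, pullbackIdent_snd, ← Category.assoc, pullbackDom_snd]) rfl, ident_mul])
    (fun h => by
      apply pullback.hom_ext
      · rw [pullbackMul_fst, mul_congr (g' := (pullback.fst _ _ ≫ X.cod) ≫ X.ident) rfl (by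
          rw [Category.assoc, pullbackIdent_fst, ← Category.assoc, pullbackCod_fst]), mul_ident]
      · rw [pullbackMul_snd, mul_congr (g' := (pullback.snd _ _ ≫ Y.cod) ≫ Y.ident) rfl (by
          rw [Category.assoc, pullbackIdent_snd, ← Category.assoc, pullbackCod_snd]), mul_ident])
    (fun _ f g k h h' h₁ h₂ => by
      apply pullback.hom_ext
      · exact (pullbackMul_fst _).trans ((mul_congr (pullbackMul_fst h) rfl).trans
          ((mul_assoc _ _).trans ((pullbackMul_fst _).trans
            (mul_congr rfl (pullbackMul_fst h'))).symm))
      · exact (pullbackMul_snd _).trans ((mul_congr (pullbackMul_snd h) rfl).trans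
          ((mul_assoc _ _).trans ((pullbackMul_snd _).trans
            (mul_congr rfl (pullbackMul_snd h'))).symm)))

/-- The first projection of the pullback of two internal functors. -/
noncomputable def pullbackObjFst : pullbackObj F G ⟶ X where
  onObj := pullback.fst F.onObj G.onObj
  onArr := pullback.fst F.onArr G.onArr
  onArr_dom := (pullbackDom_fst F G).symm
  onArr_cod := (pullbackCod_fst F G).symm
  ident_onArr := pullbackIdent_fst F G
  comp_onArr := pullbackMul_fst pullback.condition

/-- The second projection of the pullback of two internal functors. -/
noncomputable def pullbackObjSnd : pullbackObj F G ⟶ Y where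
  onObj := pullback.snd F.onObj G.onObj
  onArr := pullback.snd F.onArr G.onArr
  onArr_dom := (pullbackDom_snd F G).symm
  onArr_cod := (pullbackCod_snd F G).symm
  ident_onArr := pullbackIdent_snd F G
  comp_onArr := pullbackMul_snd pullback.condition

variable {F G}

/-- A commutative square of internal functors is a pullback if it is so on objects and on
arrows. -/
theorem isPullback_of_components {P : InternalCat C} {p : P ⟶ X} {q : P ⟶ Y}
    (w : p ≫ F = q ≫ G) (h₀ : IsPullback p.onObj q.onObj F.onObj G.onObj)
    (h₁ : IsPullback p.onArr q.onArr F.onArr G.onArr) : IsPullback p q F G := by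
  refine ⟨⟨w⟩, ⟨PullbackCone.IsLimit.mk _ (fun s => ?_) (fun s => ?_) (fun s => ?_)
    (fun s m hm₁ hm₂ => ?_)⟩⟩
  · have e₀ : s.fst.onObj ≫ F.onObj = s.snd.onObj ≫ G.onObj := congr(($s.condition).onObj)
    have e₁ : s.fst.onArr ≫ F.onArr = s.snd.onArr ≫ G.onArr := congr(($s.condition).onArr)
    refine ⟨h₀.lift _ _ e₀, h₁.lift _ _ e₁, ?_, ?_, ?_, ?_⟩
    · apply h₀.hom_ext
      · rw [Category.assoc, ← p.onArr_dom, h₁.lift_fst_assoc, Category.assoc, h₀.lift_fst,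
          s.fst.onArr_dom]
      · rw [Category.assoc, ← q.onArr_dom, h₁.lift_snd_assoc, Category.assoc, h₀.lift_snd,
          s.snd.onArr_dom]
    · apply h₀.hom_ext
      · rw [Category.assoc, ← p.onArr_cod, h₁.lift_fst_assoc, Category.assoc, h₀.lift_fst,
          s.fst.onArr_cod]
      · rw [Category.assoc, ← q.onArr_cod, h₁.lift_snd_assoc, Category.assoc, h₀.lift_snd,
          s.snd.onArr_cod]
    · apply h₁.hom_ext
      · rw [Category.assoc, h₁.lift_fst, Category.assoc, p.ident_onArr, h₀.lift_fst_assoc,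
          s.fst.ident_onArr]
      · rw [Category.assoc, h₁.lift_snd, Category.assoc, q.ident_onArr, h₀.lift_snd_assoc,
          s.snd.ident_onArr]
    · apply h₁.hom_ext
      · rw [Category.assoc, h₁.lift_fst, Category.assoc, p.comp_onArr, s.fst.comp_onArr,
          ← Category.assoc]
        congr 1
        apply pullback.hom_ext <;>
          simp [pullback.map, pullback.lift_fst, pullback.lift_snd, pullback.lift_fst_assoc,
            pullback.lift_snd_assoc]
      · rw [Category.assoc, h₁.lift_snd, Category.assoc, q.comp_onArr, s.snd.comp_onArr,
          ← Category.assoc]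
        congr 1
        apply pullback.hom_ext <;>
          simp [pullback.map, pullback.lift_fst, pullback.lift_snd, pullback.lift_fst_assoc,
            pullback.lift_snd_assoc]
  · exact Hom.ext (h₀.lift_fst _ _ _) (h₁.lift_fst _ _ _)
  · exact Hom.ext (h₀.lift_snd _ _ _) (h₁.lift_snd _ _ _)
  · refine Hom.ext (h₀.hom_ext ?_ ?_) (h₁.hom_ext ?_ ?_)
    · exact congr(($hm₁).onObj).trans (h₀.lift_fst _ _ _).symm
    · exact congr(($hm₂).onObj).trans (h₀.lift_snd _ _ _).symm
    · exact congr(($hm₁).onArr).trans (h₁.lift_fst _ _ _).symm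
    · exact congr(($hm₂).onArr).trans (h₁.lift_snd _ _ _).symm

theorem isPullback_pullbackObj :
    IsPullback (pullbackObjFst F G) (pullbackObjSnd F G) F G :=
  isPullback_of_components (Hom.ext pullback.condition pullback.condition)
    (IsPullback.of_hasPullback F.onObj G.onObj) (IsPullback.of_hasPullback F.onArr G.onArr)

/-- The object of objects of an internal category, as a functor. -/
def objFunctor (C : Type u) [Category.{v} C] [HasFiniteLimits C] : InternalCat C ⥤ C where
  obj A := A.obj₀
  map F := F.onObj

/-- The object of arrows of an internal category, as a functor. -/
def arrFunctor (C : Type u) [Category.{v} C] [HasFiniteLimits C] : InternalCat C ⥤ C where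
  obj A := A.arr
  map F := F.onArr

/-- Pullbacks of internal functors are computed componentwise. -/
theorem isPullback_onObj {P : InternalCat C} {p : P ⟶ X} {q : P ⟶ Y} (h : IsPullback p q F G) :
    IsPullback p.onObj q.onObj F.onObj G.onObj :=
  -- Any pullback is isomorphic to the componentwise one, and `objFunctor` carries this isomorphism
  -- to `C`.
  IsPullback.of_iso (IsPullback.of_hasPullback F.onObj G.onObj)
    ((objFunctor C).mapIso (isPullback_pullbackObj.isoIsPullback _ _ h))
    (Iso.refl _) (Iso.refl _) (Iso.refl _)
    ((Category.comp_id _).trans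
      congr(($(isPullback_pullbackObj.isoIsPullback_hom_fst _ _ h)).onObj).symm)
    ((Category.comp_id _).trans
      congr(($(isPullback_pullbackObj.isoIsPullback_hom_snd _ _ h)).onObj).symm)
    (by simp) (by simp)

theorem isPullback_onArr {P : InternalCat C} {p : P ⟶ X} {q : P ⟶ Y} (h : IsPullback p q F G) :
    IsPullback p.onArr q.onArr F.onArr G.onArr :=
  IsPullback.of_iso (IsPullback.of_hasPullback F.onArr G.onArr)
    ((arrFunctor C).mapIso (isPullback_pullbackObj.isoIsPullback _ _ h))
    (Iso.refl _) (Iso.refl _) (Iso.refl _)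
    ((Category.comp_id _).trans
      congr(($(isPullback_pullbackObj.isoIsPullback_hom_fst _ _ h)).onArr).symm)
    ((Category.comp_id _).trans
      congr(($(isPullback_pullbackObj.isoIsPullback_hom_snd _ _ h)).onArr).symm)
    (by simp) (by simp)

end InternalCat

/-! ### Local quotients and stable units. -/

section StableUnits

variable {C : Type u} [Category.{v} C]

/-- In a regular category `q` is the coequalizer of some pair, to which the hypothesis applies. -/
theorem exists_desc_of_strongEpi [Regular C] {X Y Z : C} (q : X ⟶ Y) [StrongEpi q] (f : X ⟶ Z)
    (h : ∀ ⦃T : C⦄ (a b : T ⟶ X), a ≫ q = b ≫ q → a ≫ f = b ≫ f) : ∃ g : Y ⟶ Z, q ≫ g = f := by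
  have : IsRegularEpi q := inferInstance
  let s := IsRegularEpi.getStruct q
  obtain ⟨g, hg⟩ := Cofork.IsColimit.desc' s.isColimit f (h _ _ s.w)
  exact ⟨g, hg⟩

namespace InternalCat

/-- An internal functor to an internal preorder is a *local quotient* if it is a strong epimorphism
on objects and on arrows, and locally any two identified objects are linked by an arrow. -/
structure IsLocalQuotient [HasFiniteLimits C] {X : InternalCat C} {Q : InternalPreord C}
    (η : X ⟶ Q.toInternalCat) : Prop where
  strongEpi_onObj : StrongEpi η.onObj
  strongEpi_onArr : StrongEpi η.onArr
  exists_arrow : ∀ ⦃T : C⦄ (a b : T ⟶ X.obj₀), a ≫ η.onObj = b ≫ η.onObj →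
    ∃ (T' : C) (e : T' ⟶ T) (x : T' ⟶ X.arr), StrongEpi e ∧ x ≫ X.dom = e ≫ a ∧
      x ≫ X.cod = e ≫ b

/-- On objects the unit is the coequalizer `quotπ`, and on arrows a composite of two image
projections. Identified objects are comparable in the preorder reflection, which means joined by an
arrow over a cover. -/
theorem isLocalQuotient_unit [BarrExact C] (X : InternalCat C) :
    IsLocalQuotient (Q := X.preord.antisymm)
      (X.toPreord ≫ (internalPreordToCat C).map X.preord.toAntisymm) where
  strongEpi_onObj := by
    have : StrongEpi (𝟙 X.preord.carrier ≫ X.preord.quotπ) := by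
      rw [Category.id_comp]; infer_instance
    exact this
  strongEpi_onArr := @strongEpi_comp _ _ _ _ _ (InternalPreord.spanRelπ X.dom X.cod)
    (InternalPreord.spanRelπ (X.preord.r₁ ≫ X.preord.quotπ) (X.preord.r₂ ≫ X.preord.quotπ))
    (InternalPreord.strongEpi_spanRelπ _ _) (InternalPreord.strongEpi_spanRelπ _ _)
  exists_arrow T a b h := by
    have hid : 𝟙 X.preord.carrier ≫ X.preord.quotπ = X.preord.quotπ := Category.id_comp _
    have h' : (a : T ⟶ X.preord.carrier) ≫ X.preord.quotπ = b ≫ X.preord.quotπ :=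
      (a ≫= hid).symm.trans (h.trans (b ≫= hid))
    exact X.exists_arrow_of_preord_le (InternalPreord.comp_quotπ_eq_iff.1 h').1

section

variable [Regular C] {X Y P : InternalCat C} {Q : InternalPreord C} {η : X ⟶ Q.toInternalCat}
  {φ : Y ⟶ Q.toInternalCat} {p : P ⟶ X} {q : P ⟶ Y}

/-- Arrows of a pullback over an internal preorder are pairs of arrows which agree on
endpoints. -/
theorem exists_arrow_of_isPullback (h : IsPullback p q η φ) {T : C} (x : T ⟶ X.arr)
    (y : T ⟶ Y.arr) (a b : T ⟶ P.obj₀)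
    (ha : x ≫ X.dom = a ≫ p.onObj) (ha' : y ≫ Y.dom = a ≫ q.onObj)
    (hb : x ≫ X.cod = b ≫ p.onObj) (hb' : y ≫ Y.cod = b ≫ q.onObj) :
    ∃ w : T ⟶ P.arr, w ≫ P.dom = a ∧ w ≫ P.cod = b := by
  have h₀ := isPullback_onObj h
  have h₁ := isPullback_onArr h
  -- The images of `x` and `y` in `Q` have the same endpoints, hence are equal because `Q` is a
  -- preorder.
  have hw : x ≫ η.onArr = y ≫ φ.onArr := by
    apply Q.jointlyMono.right_cancellation
    · change (x ≫ η.onArr) ≫ Q.toInternalCat.dom = (y ≫ φ.onArr) ≫ Q.toInternalCat.dom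
      rw [Category.assoc, η.onArr_dom, reassoc_of% ha, h₀.w, Category.assoc, φ.onArr_dom,
        reassoc_of% ha']
    · change (x ≫ η.onArr) ≫ Q.toInternalCat.cod = (y ≫ φ.onArr) ≫ Q.toInternalCat.cod
      rw [Category.assoc, η.onArr_cod, reassoc_of% hb, h₀.w, Category.assoc, φ.onArr_cod,
        reassoc_of% hb']
  refine ⟨h₁.lift x y hw, h₀.hom_ext ?_ ?_, h₀.hom_ext ?_ ?_⟩
  · rw [Category.assoc, ← p.onArr_dom, h₁.lift_fst_assoc, ha]
  · rw [Category.assoc, ← q.onArr_dom, h₁.lift_snd_assoc, ha']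
  · rw [Category.assoc, ← p.onArr_cod, h₁.lift_fst_assoc, hb]
  · rw [Category.assoc, ← q.onArr_cod, h₁.lift_snd_assoc, hb']

theorem IsLocalQuotient.le_of_isPullback (hη : IsLocalQuotient η) (h : IsPullback p q η φ)
    {Z : InternalPreord C} (f : P ⟶ Z.toInternalCat) {T : C} {a b : T ⟶ P.obj₀}
    (hab : a ≫ q.onObj = b ≫ q.onObj) : Z.Le (a ≫ f.onObj) (b ≫ f.onObj) := by
  have h₀ := isPullback_onObj h
  obtain ⟨T', e, x, _, ha, hb⟩ := hη.exists_arrow (a ≫ p.onObj) (b ≫ p.onObj)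
    (by rw [Category.assoc, h₀.w, reassoc_of% hab, Category.assoc, h₀.w])
  -- The component in `Y` is the identity of the common image of `a` and `b`.
  obtain ⟨w, hwa, hwb⟩ := exists_arrow_of_isPullback h x (e ≫ a ≫ q.onObj ≫ Y.ident) (e ≫ a)
    (e ≫ b) (by simp [ha]) (by simp [Y.ident_dom]) (by simp [hb]) (by simp [Y.ident_cod, hab])
  exact (le_of_arrow f w hwa hwb).of_cover e (Category.assoc _ _ _) (Category.assoc _ _ _)

/-- Internal functors into an internal partial order extend uniquely along the pullback of a
local quotient. -/
theorem IsLocalQuotient.bijective_of_isPullback (hη : IsLocalQuotient η) (h : IsPullback p q η φ)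
    {Z : InternalPreord C} (hZ : InternalPreord.isAntisymm C Z) :
    Function.Bijective fun f : Y ⟶ Z.toInternalCat => q ≫ f := by
  have h₀ := isPullback_onObj h
  have h₁ := isPullback_onArr h
  have := hη.strongEpi_onObj
  have := hη.strongEpi_onArr
  have hq₀ : StrongEpi q.onObj := strongEpi_snd_of_isPullback h₀
  have hq₁ : StrongEpi q.onArr := strongEpi_snd_of_isPullback h₁
  refine ⟨fun f g hfg => hom_ext_toPreord Z ?_, fun f => ?_⟩
  · have : q.onObj ≫ f.onObj = q.onObj ≫ g.onObj := congr(($hfg).onObj)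
    exact (cancel_epi q.onObj).1 this
  · obtain ⟨g, hg⟩ := exists_desc_of_strongEpi q.onObj f.onObj fun T a b hab =>
      InternalPreord.isAntisymm_iff.1 hZ _ _ (hη.le_of_isPullback h f hab)
        (hη.le_of_isPullback h f hab.symm)
    -- Arrows of `Y` lift along the cover `q.onArr` to arrows of `P`, on which `f` gives the
    -- inequality.
    have hle : Z.Le (Y.dom ≫ g) (Y.cod ≫ g) := by
      refine (le_of_arrow f (𝟙 _) (Category.id_comp _) (Category.id_comp _)).of_cover q.onArr ?_ ?_
      · exact (P.dom ≫= hg).symm.trans ((reassoc_of% q.onArr_dom) g).symm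
      · exact (P.cod ≫= hg).symm.trans ((reassoc_of% q.onArr_cod) g).symm
    obtain ⟨t, ht₁, ht₂⟩ := hle
    exact ⟨homToPreord g t ht₁ ht₂, hom_ext_toPreord Z hg⟩

end

end InternalCat

/-- A reflector has stable units as soon as the pullback of any unit is orthogonal to the
reflective subcategory. -/
theorem hasStableUnits_of_bijective {B : Type u₁} [Category.{v₁} B] {A : Type u₂}
    [Category.{v₂} A] {G : B ⥤ A} {V : A ⥤ B} (adj : G ⊣ V) [V.Full] [V.Faithful]
    (H : ∀ ⦃X Y P : B⦄ (p₁ : P ⟶ X) (p₂ : P ⟶ Y) (φ : Y ⟶ V.obj (G.obj X)),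
      IsPullback p₁ p₂ (adj.unit.app X) φ →
        ∀ Z : A, Function.Bijective fun f : Y ⟶ V.obj Z => p₂ ≫ f) :
    HasStableUnits adj := by
  intro X Y P p₁ p₂ φ h
  -- By Yoneda: through the adjunction, the bijections `H` become precomposition with `G.map p₂`.
  have : IsIso (G.map p₂) := by
    refine isIso_of_coyoneda_map_bijective _ fun Z => ?_
    have := ((adj.homEquiv P Z).symm.bijective.comp (H p₁ p₂ φ h Z)).comp
      (adj.homEquiv Y Z).bijective
    convert this using 1
    ext g
    simp [Adjunction.homEquiv_counit, Adjunction.homEquiv_unit]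
  -- The reflector also inverts the unit, since `V` is full and faithful, so two opposite sides are
  -- isomorphisms.
  exact IsPullback.of_vert_isIso ⟨by rw [← G.map_comp, h.w, G.map_comp]⟩

/-- Every left adjoint of the inclusion of internal partial orders into internal categories has
stable units. -/
theorem hasStableUnits_internalParOrdToCat [BarrExact C] {L : InternalCat C ⥤ InternalParOrd C}
    (adj : L ⊣ internalParOrdToCat C) : HasStableUnits adj := by
  refine hasStableUnits_of_bijective adj fun X Y P p q φ h Z => ?_
  let adj' := internalPreordAdjunction.comp (internalParOrdAdjunction (C := C))
  -- Left adjoints are unique up to isomorphism, so the unit of `adj` followed by `i` is the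
  -- explicit unit. Replacing `φ` by `φ ≫ i.hom` keeps the square a pullback with the same `q`.
  let i := (internalParOrdToCat C).mapIso ((adj.leftAdjointUniq adj').app X)
  have hi : adj.unit.app X ≫ i.hom =
      X.toPreord ≫ (internalPreordToCat C).map X.preord.toAntisymm := by
    refine (adj.unit_leftAdjointUniq_hom_app adj' X).trans ?_
    simp only [adj', Adjunction.comp_unit_app]
    rw [internalPreordAdjunction_unit_app]
    exact congr(X.toPreord ≫ (internalPreordToCat C).map
      $(internalParOrdAdjunction_unit_app X.preord))
  have h' : IsPullback p q (X.toPreord ≫ (internalPreordToCat C).map X.preord.toAntisymm)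
      (φ ≫ i.hom) :=
    .of_iso h (Iso.refl _) (Iso.refl _) (Iso.refl _) i (by simp) (by simp)
      (hi.trans (Category.id_comp _).symm) (by simp)
  exact X.isLocalQuotient_unit.bijective_of_isPullback h' Z.property

end StableUnits

theorem mainTheorem12 (C : Type u) [Category.{v} C] [BarrExact C] :
    -- the inclusions `V`, `U` and `W` exhibit reflective (full) subcategories
    Nonempty (Reflective (internalPreordToCat C)) ∧
    Nonempty (Reflective (internalParOrdToPreord C)) ∧
    Nonempty (Reflective (internalParOrdToCat C)) ∧
    -- the composite `G ⋙ F` of the two reflectors has stable units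
    (∀ (G : InternalCat C ⥤ InternalPreord C) (F : InternalPreord C ⥤ InternalParOrd C)
      (adjG : G ⊣ internalPreordToCat C) (adjF : F ⊣ internalParOrdToPreord C),
      HasStableUnits (adjG.comp adjF)) ∧
    -- and so does every reflector `L`, left adjoint to `W`
    (∀ (L : InternalCat C ⥤ InternalParOrd C) (adj : L ⊣ internalParOrdToCat C),
      HasStableUnits adj) :=
  ⟨⟨⟨_, internalPreordAdjunction⟩⟩, ⟨⟨_, internalParOrdAdjunction⟩⟩,
    ⟨⟨_, internalPreordAdjunction.comp internalParOrdAdjunction⟩⟩,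
    fun _ _ _ _ => hasStableUnits_internalParOrdToCat _,
    fun _ _ => hasStableUnits_internalParOrdToCat _⟩
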